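/- Let $X$ be a Tychonoff (completely regular Hausdorff) space, and let $B_1(X)$ be the real vector space of all Baire-one functions on $X$, i.e. of all $f:X\to\mathbb{R}$ that are pointwise limits of sequences of continuous real-valued functions on $X$, endowed with the topology of pointwise convergence (the topology induced from the product $\mathbb{R}^X$). Then the following assertions are equivalent: (i) $B_1(X)$ is a Montel space; (ii) $B_1(X)$ is a semi-Montel space; (iii) $B_1(X)$ is a reflexive space; (iv) $B_1(X)$ is a semi-reflexive space; (v) $B_1(X)$ is a complete space; (vi) $B_1(X)$ is a quasi-complete space; (vii) $B_1(X)=\mathbb{R}^X$, i.e. every function $X\to\mathbb{R}$ is Baire-one; (viii) $X$ is a $Q_f$-space, i.e. every subset of $X$ is both a $\mathrm{Zer}_\sigma$-set and a $\mathrm{Coz}_\delta$-set. Here a zero-set is a set of the form $f^{-1}(0)$ with $f:X\to\mathbb{R}$ continuous, a cozero-set is the complement of a zero-set, a $\mathrm{Zer}_\sigma$-set is a countable union of zero-sets, and a $\mathrm{Coz}_\delta$-set is a countable intersection of cozero-sets. For a Hausdorff locally convex space $E$ over $\mathbb{R}$, let $E'_\beta$ be the space of continuous linear functionals on $E$ with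 the strong topology (uniform convergence on bounded subsets of $E$), let $E''=(E'_\beta)'_\beta$, and let $\psi_E:E\to E''$, $\psi_E(x)(\chi)=\chi(x)$, be the canonical map. Then $E$ is semi-reflexive if $\psi_E$ is surjective; reflexive if $\psi_E$ is a topological isomorphism; semi-Montel if every bounded subset of $E$ is relatively compact (has compact closure); Montel if it is semi-Montel and reflexive; complete if every Cauchy net in $E$ converges; and quasi-complete if every closed bounded subset of $E$ is complete. -/

import Mathlib

open Filter Topology Set

namespace BaireOne

section Sets

variable {X : Type*} [TopologicalSpace X]

/-- A zero-set of `X`: the set of zeros of a continuous real-valued function. -/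
def IsZeroSet (A : Set X) : Prop := ∃ f : C(X, ℝ), A = {x | f x = 0}

/-- A cozero-set of `X`: the complement of a zero-set. -/
def IsCozeroSet (A : Set X) : Prop := IsZeroSet Aᶜ

/-- A `Zer_σ`-set: a countable union of zero-sets. -/
def IsZerSigma (A : Set X) : Prop :=
  ∃ Z : ℕ → Set X, (∀ n, IsZeroSet (Z n)) ∧ A = ⋃ n, Z n

/-- A `Coz_δ`-set: a countable intersection of cozero-sets. -/
def IsCozDelta (A : Set X) : Prop :=
  ∃ U : ℕ → Set X, (∀ n, IsCozeroSet (U n)) ∧ A = ⋂ n, U n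

/-- A `CZ`-set: a set that is both a `Zer_σ`-set and a `Coz_δ`-set. -/
def IsCZSet (A : Set X) : Prop := IsZerSigma A ∧ IsCozDelta A

end Sets

/-- A `Q_f`-space: every subset is a `CZ`-set. -/
def IsQfSpace (X : Type*) [TopologicalSpace X] : Prop := ∀ A : Set X, IsCZSet A

/-- A Baire-one function: a pointwise limit of a sequence of continuous real-valued functions. -/
def IsBaireOne {X : Type*} [TopologicalSpace X] (f : X → ℝ) : Prop :=
  ∃ F : ℕ → C(X, ℝ), ∀ x, Tendsto (fun n => F n x) atTop (𝓝 (f x))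

/-- The space `B₁(X)`, as a linear subspace of `ℝ^X`. As a type, it carries the subspace topology
(and uniformity) of the product `X → ℝ`, that is, the topology of pointwise convergence. -/
def B1 (X : Type*) [TopologicalSpace X] : Submodule ℝ (X → ℝ) where
  carrier := {f | IsBaireOne f}
  zero_mem' := ⟨fun _ => 0, fun _ => tendsto_const_nhds⟩
  add_mem' := by
    rintro f g ⟨F, hF⟩ ⟨G, hG⟩
    exact ⟨fun n => F n + G n, fun x => (hF x).add (hG x)⟩
  smul_mem' := by
    rintro c f ⟨F, hF⟩
    exact ⟨fun n => c • F n, fun x => (hF x).const_smul c⟩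

section LocallyConvex

variable (E : Type*) [AddCommGroup E] [Module ℝ E]

section Topological

variable [TopologicalSpace E]

/-- Every (von Neumann) bounded subset is relatively compact. -/
def IsSemiMontel : Prop := ∀ s : Set E, Bornology.IsVonNBounded ℝ s → IsCompact (closure s)

variable [IsTopologicalAddGroup E] [ContinuousSMul ℝ E]

/-- The canonical evaluation map `ψ_E : E → E''`, `ψ_E x χ = χ x`. Here `StrongDual ℝ E` is the
space of continuous linear functionals with the strong topology `β(E', E)`, the topology of
uniform convergence on the bounded subsets of `E`; the bidual is the strong dual of it. -/
def bidualMap : E →ₗ[ℝ] StrongDual ℝ (StrongDual ℝ E) where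
  toFun x :=
    { toFun := fun χ => χ x
      map_add' := fun _ _ => rfl
      map_smul' := fun _ _ => rfl
      cont := continuous_eval_const x }
  map_add' x y := by ext χ; exact map_add χ x y
  map_smul' c x := by ext χ; exact map_smul χ c x

/-- The canonical map into the bidual is surjective. -/
def IsSemiReflexive : Prop := Function.Surjective (bidualMap E)

/-- The (linear) canonical map into the strong bidual is a topological isomorphism. -/
def IsReflexive : Prop := IsHomeomorph (bidualMap E)

/-- Semi-Montel and reflexive. -/
def IsMontel : Prop := IsSemiMontel E ∧ IsReflexive E

end Topological

/-- Every closed bounded subset is complete. -/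
def IsQuasiComplete [UniformSpace E] : Prop :=
  ∀ s : Set E, IsClosed s → Bornology.IsVonNBounded ℝ s → IsComplete s

end LocallyConvex

end BaireOne

namespace BaireOne

/-! ### Baire-one functions and `Q_f`-spaces. -/

section FunctionTheory

variable {X : Type*} [TopologicalSpace X]

/-! Quasi-completeness is the hub: it is the weakest of the topological conditions, and it forces
`B1 X = ⊤`. The Baire-one functions bounded by 1 form a closed bounded set; if it is complete, it is
closed in `X → ℝ`, while interpolation on finite sets makes it dense among all functions bounded by
1. So every indicator is Baire-one and `X` is a `Q_f`-space. In a `Q_f`-space every function is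
Baire-one, by binary expansion and a sigmoid change of variable. Conversely, `ℝ^X` is complete, its
bounded sets are relatively compact by Tychonoff's theorem, and it is reflexive: functionals are
finite combinations of evaluations, and a strongly bounded set of them has a common finite support.
-/

theorem isZeroSet_le_const (f : C(X, ℝ)) (c : ℝ) : IsZeroSet {x | f x ≤ c} := by
  refine ⟨⟨fun x => max (f x - c) 0, by fun_prop⟩, ?_⟩
  ext x
  simp

theorem IsZeroSet.iInter {Z : ℕ → Set X} (hZ : ∀ n, IsZeroSet (Z n)) : IsZeroSet (⋂ n, Z n) := by
  choose z hz using hZ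
  -- Truncating at 1 makes the weighted series uniformly convergent without changing the zeros.
  have hbound : ∀ n x, ‖min |z n x| 1 * (1 / 2 : ℝ) ^ n‖ ≤ (1 / 2 : ℝ) ^ n := by
    intro n x
    rw [Real.norm_of_nonneg (by positivity)]
    exact mul_le_of_le_one_left (by positivity) (min_le_right _ _)
  have hsum : ∀ x, Summable fun n => min |z n x| 1 * (1 / 2 : ℝ) ^ n := fun x =>
    Summable.of_norm_bounded summable_geometric_two fun n => hbound n x
  refine ⟨⟨fun x => ∑' n, min |z n x| 1 * (1 / 2 : ℝ) ^ n,
    continuous_tsum (fun n => by fun_prop) summable_geometric_two hbound⟩, ?_⟩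
  ext x
  have hzero : (∑' n, min |z n x| 1 * (1 / 2 : ℝ) ^ n) = 0 ↔
      ∀ n, min |z n x| 1 * (1 / 2 : ℝ) ^ n = 0 := by
    rw [← (hsum x).hasSum_iff, hasSum_zero_iff_of_nonneg fun n => by positivity, funext_iff]
    rfl
  simp only [ContinuousMap.coe_mk, mem_ofPred_eq, mem_iInter, hz, hzero]
  refine forall_congr' fun n => ?_
  constructor
  · intro h
    simp [h]
  · intro h
    have h' : min |z n x| 1 = 0 := by simpa using h
    rcases min_choice |z n x| 1 with h1 | h1
    · simpa [h'] using h1.symm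
    · simp [h'] at h1

theorem isZerSigma_of_isBaireOne_indicator {A : Set X}
    (h : IsBaireOne (A.indicator (1 : X → ℝ))) : IsZerSigma A := by
  obtain ⟨F, hF⟩ := h
  -- The limit is 0 or 1, so it is 1 exactly where a tail of the sequence stays at or above 1/2.
  refine ⟨fun N => ⋂ n, {x | (-F (N + n)) x ≤ -(1 / 2)},
    fun N => IsZeroSet.iInter fun n => isZeroSet_le_const _ _, ?_⟩
  ext x
  simp only [mem_iUnion, mem_iInter, mem_ofPred_eq, ContinuousMap.neg_apply, neg_le_neg_iff]
  constructor
  · intro hx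
    have hlim := hF x
    rw [indicator_of_mem hx] at hlim
    obtain ⟨N, hN⟩ := eventually_atTop.1 (hlim.eventually_const_lt (u := 1 / 2) (by norm_num))
    exact ⟨N, fun n => (hN _ (Nat.le_add_right _ _)).le⟩
  · rintro ⟨N, hN⟩
    by_contra hx
    have hlim := hF x
    rw [indicator_of_notMem hx] at hlim
    have : (1 / 2 : ℝ) ≤ 0 := ge_of_tendsto hlim <| by
      filter_upwards [eventually_ge_atTop N] with n hn
      simpa [Nat.add_sub_cancel' hn] using hN (n - N)
    norm_num at this

theorem IsZerSigma.isCozDelta_of_compl {A : Set X} (h : IsZerSigma Aᶜ) : IsCozDelta A := by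
  obtain ⟨Z, hZ, hA⟩ := h
  exact ⟨fun n => (Z n)ᶜ, fun n => by simpa [IsCozeroSet] using hZ n,
    by rw [← compl_iUnion, ← hA, compl_compl]⟩

theorem IsCozDelta.isZerSigma_compl {A : Set X} (h : IsCozDelta A) : IsZerSigma Aᶜ := by
  obtain ⟨U, hU, hA⟩ := h
  exact ⟨fun n => (U n)ᶜ, hU, by rw [hA, compl_iInter]⟩

theorem isQfSpace_of_bounded (h : ∀ f : X → ℝ, (∀ x, |f x| ≤ 1) → IsBaireOne f) :
    IsQfSpace X := by
  have key : ∀ A : Set X, IsZerSigma A := fun A => by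
    refine isZerSigma_of_isBaireOne_indicator (h _ fun x => ?_)
    by_cases hx : x ∈ A <;> simp [hx]
  exact fun A => ⟨key A, (key Aᶜ).isCozDelta_of_compl⟩

/-- The indicator of a `CZ`-set is a pointwise limit of continuous functions valued in `[0, 1]`. -/
theorem IsCZSet.exists_tendsto_indicator {A : Set X} (h : IsCZSet A) :
    ∃ F : ℕ → C(X, ℝ), (∀ n x, F n x ∈ Icc (0 : ℝ) 1) ∧
      ∀ x, Tendsto (fun n => F n x) atTop (𝓝 (A.indicator 1 x)) := by
  obtain ⟨⟨Z, hZ, hA⟩, hco⟩ := h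
  obtain ⟨W, hW, hAc⟩ := hco.isZerSigma_compl
  choose z hz using hZ
  choose w hw using hW
  -- `p n` is positive off `A` and eventually 0 at each point of `A`; `q n` does the opposite. Hence
  -- `q / (p + q)` is eventually equal to the indicator at each point.
  set p : ℕ → X → ℝ := fun n x => ∏ i ∈ Finset.range n, |z i x| with hp
  set q : ℕ → X → ℝ := fun n x => ∏ i ∈ Finset.range n, |w i x| with hq
  have hp0 : ∀ n x, 0 ≤ p n x := fun n x => Finset.prod_nonneg fun _ _ => abs_nonneg _
  have hq0 : ∀ n x, 0 ≤ q n x := fun n x => Finset.prod_nonneg fun _ _ => abs_nonneg _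
  have hpA : ∀ x ∉ A, ∀ n, 0 < p n x := by
    intro x hx n
    refine Finset.prod_pos fun i _ => abs_pos.2 fun h0 => hx ?_
    rw [hA]
    exact mem_iUnion.2 ⟨i, by rw [hz i]; exact h0⟩
  have hqA : ∀ x ∈ A, ∀ n, 0 < q n x := by
    intro x hx n
    refine Finset.prod_pos fun i _ => abs_pos.2 fun h0 => ?_
    have : x ∈ Aᶜ := by
      rw [hAc]
      exact mem_iUnion.2 ⟨i, by rw [hw i]; exact h0⟩
    exact this hx
  have hpos : ∀ n x, 0 < p n x + q n x := by
    intro n x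
    by_cases hx : x ∈ A
    · exact add_pos_of_nonneg_of_pos (hp0 n x) (hqA x hx n)
    · exact add_pos_of_pos_of_nonneg (hpA x hx n) (hq0 n x)
  have hpc : ∀ n, Continuous (p n) := fun n => by fun_prop
  have hqc : ∀ n, Continuous (q n) := fun n => by fun_prop
  refine ⟨fun n => ⟨fun x => q n x / (p n x + q n x),
    (hqc n).div ((hpc n).add (hqc n)) fun x => (hpos n x).ne'⟩, fun n x => ⟨?_, ?_⟩, fun x => ?_⟩
  · exact div_nonneg (hq0 n x) (hpos n x).le
  · exact div_le_one_of_le₀ (le_add_of_nonneg_left (hp0 n x)) (hpos n x).le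
  by_cases hx : x ∈ A
  · obtain ⟨i, hi⟩ := mem_iUnion.1 (hA ▸ hx)
    rw [indicator_of_mem hx]
    refine tendsto_const_nhds.congr' ?_
    filter_upwards [eventually_gt_atTop i] with n hn
    have hi' : z i x = 0 := by rw [hz i] at hi; exact hi
    have h0 : p n x = 0 :=
      Finset.prod_eq_zero (Finset.mem_range.2 hn) (abs_eq_zero.2 hi')
    simp [h0, (hqA x hx n).ne']
  · obtain ⟨i, hi⟩ := mem_iUnion.1 (hAc ▸ (mem_compl hx))
    rw [indicator_of_notMem hx]
    refine tendsto_const_nhds.congr' ?_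
    filter_upwards [eventually_gt_atTop i] with n hn
    have hi' : w i x = 0 := by rw [hw i] at hi; exact hi
    have h0 : q n x = 0 :=
      Finset.prod_eq_zero (Finset.mem_range.2 hn) (abs_eq_zero.2 hi')
    simp [h0]

/-- Each binary digit of `f` is the indicator of a `CZ`-set; the weights `2 ^ -(k + 1)` allow the
limit to pass through the sum. -/
theorem IsQfSpace.isBaireOne_of_mem_Ico (h : IsQfSpace X) {f : X → ℝ}
    (hf : ∀ x, f x ∈ Ico (0 : ℝ) 1) : IsBaireOne f := by
  choose F hF01 hF using fun k : ℕ =>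
    (h {x | Real.digits (f x) 2 k = 1}).exists_tendsto_indicator
  have hbound : ∀ n k x, ‖F k n x * ((2 : ℝ) ^ (k + 1))⁻¹‖ ≤ ((2 : ℝ) ^ (k + 1))⁻¹ := by
    intro n k x
    rw [norm_mul, Real.norm_of_nonneg (hF01 k n x).1,
      Real.norm_of_nonneg (r := ((2 : ℝ) ^ (k + 1))⁻¹) (by positivity)]
    exact mul_le_of_le_one_left (by positivity) (hF01 k n x).2
  have hsum : Summable fun k : ℕ => ((2 : ℝ) ^ (k + 1))⁻¹ := by
    simp_rw [← inv_pow]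
    exact (summable_nat_add_iff 1).2
      (summable_geometric_of_lt_one (by norm_num) (by norm_num))
  refine ⟨fun n => ⟨fun x => ∑' k, F k n x * ((2 : ℝ) ^ (k + 1))⁻¹,
    continuous_tsum (fun k => by fun_prop) hsum (hbound n)⟩, fun x => ?_⟩
  have hfx : f x = ∑' k, ({x | Real.digits (f x) 2 k = 1}.indicator 1 x : ℝ) *
      ((2 : ℝ) ^ (k + 1))⁻¹ := by
    conv_lhs => rw [← Real.ofDigits_digits (b := 2) (by norm_num) (hf x)]
    refine tsum_congr fun k => ?_
    rw [Real.ofDigitsTerm]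
    by_cases hk : Real.digits (f x) 2 k = 1
    · simp [hk]
    · have hk' : Real.digits (f x) 2 k = 0 := by omega
      simp [hk']
  rw [hfx]
  exact tendsto_tsum_of_dominated_convergence hsum (fun k => (hF k x).mul_const _)
    (Eventually.of_forall fun n k => hbound n k x)

theorem IsQfSpace.isBaireOne (h : IsQfSpace X) (f : X → ℝ) : IsBaireOne f := by
  obtain ⟨G, hG⟩ := h.isBaireOne_of_mem_Ico (f := fun x => Real.sigmoid (f x))
    fun x => ⟨Real.sigmoid_nonneg _, Real.sigmoid_lt_one _⟩
  -- Clipping keeps the approximants strictly inside (0, 1), where the inverse of the sigmoid is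
  -- continuous. The denominator `n + 2` keeps the margin below 1 already at `n = 0`.
  set c : ℕ → X → ℝ := fun n x =>
    max (1 / ((n : ℝ) + 1 + 1)) (min (1 - 1 / ((n : ℝ) + 1 + 1)) (G n x)) with hc
  have hε : ∀ n : ℕ, 0 < 1 / ((n : ℝ) + 1 + 1) := fun n => by positivity
  have hε' : ∀ n : ℕ, 1 / ((n : ℝ) + 1 + 1) < 1 := fun n => by
    rw [div_lt_one (by positivity)]
    linarith [n.cast_nonneg (α := ℝ)]
  have hc0 : ∀ n x, 0 < c n x := fun n x => lt_max_of_lt_left (hε n)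
  have hc1 : ∀ n x, c n x < 1 := fun n x =>
    max_lt (hε' n) (min_lt_of_left_lt (by linarith [hε n]))
  have hcc : ∀ n, Continuous (c n) := fun n => by fun_prop
  have hlim : ∀ x, Tendsto (fun n => c n x) atTop (𝓝 (Real.sigmoid (f x))) := by
    intro x
    have h0 : Tendsto (fun n : ℕ => 1 / ((n : ℝ) + 1 + 1)) atTop (𝓝 0) := by
      simpa using (tendsto_add_atTop_iff_nat 1).2
        (tendsto_one_div_add_atTop_nhds_zero_nat (𝕜 := ℝ))
    have := h0.max ((h0.const_sub 1).min (hG x))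
    simpa [hc, min_eq_right (Real.sigmoid_le_one _), max_eq_right (Real.sigmoid_nonneg _)] using this
  refine ⟨fun n => ⟨fun x => Real.log (c n x / (1 - c n x)), ?_⟩, fun x => ?_⟩
  · refine Continuous.log ((hcc n).div (continuous_const.sub (hcc n)) fun x => ?_) fun x => ?_
    · exact (sub_pos.2 (hc1 n x)).ne'
    · exact (div_pos (hc0 n x) (sub_pos.2 (hc1 n x))).ne'
  · have hs : Real.sigmoid (f x) / (1 - Real.sigmoid (f x)) = Real.exp (f x) := by
      rw [← Real.sigmoid_neg, ← Real.sigmoid_mul_rexp_neg, Real.exp_neg]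
      have := (Real.sigmoid_pos (f x)).ne'
      field_simp
    have h1 : 1 - Real.sigmoid (f x) ≠ 0 := (sub_pos.2 (Real.sigmoid_lt_one _)).ne'
    have := ((hlim x).div ((hlim x).const_sub 1) h1).log (by rw [hs]; positivity)
    rw [hs, Real.log_exp] at this
    exact this

theorem B1_eq_top_iff_forall : B1 X = ⊤ ↔ ∀ f : X → ℝ, IsBaireOne f :=
  Submodule.eq_top_iff'

theorem B1_eq_top_iff_isQfSpace : B1 X = ⊤ ↔ IsQfSpace X := by
  rw [B1_eq_top_iff_forall]
  exact ⟨fun h => isQfSpace_of_bounded fun f _ => h f, fun h => h.isBaireOne⟩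

theorem isBaireOne_of_continuous (f : C(X, ℝ)) : IsBaireOne f :=
  ⟨fun _ => f, fun _ => tendsto_const_nhds⟩

/-- In a Tychonoff space, functions bounded by a constant are interpolated on finite sets by
continuous functions with the same bound. -/
theorem exists_continuousMap_eqOn_finset [T35Space X] (s : Finset X) (f : X → ℝ) {M : ℝ}
    (hM : 0 ≤ M) (hf : ∀ x, |f x| ≤ M) : ∃ g : C(X, ℝ), (∀ x, |g x| ≤ M) ∧ ∀ x ∈ s, g x = f x := by
  -- A finite set is closed and discrete in the Stone–Čech compactification, so Tietze's theorem
  -- applies there; truncation restores the bound.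
  have he : IsClosedEmbedding fun x : s => stoneCechUnit (x : X) :=
    (continuous_stoneCechUnit.comp continuous_subtype_val).isClosedEmbedding
      (injective_stoneCechUnit_of_t35Space.comp Subtype.val_injective)
  obtain ⟨g, hg⟩ := ContinuousMap.exists_extension he
    (⟨fun x => f x, continuous_of_discreteTopology⟩ : C(s, ℝ))
  refine ⟨⟨fun x => max (-M) (min M (g (stoneCechUnit x))),
    by have := continuous_stoneCechUnit (α := X); fun_prop⟩, fun x => ?_, fun x hx => ?_⟩
  · exact abs_le.2 ⟨le_max_left _ _, max_le (by linarith) (min_le_left _ _)⟩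
  · have hgx : g (stoneCechUnit x) = f x := congr($hg ⟨x, hx⟩)
    have := abs_le.1 (hf x)
    simp [hgx, this.1, this.2]

end FunctionTheory

/-! ### Bounded sets, completeness and functionals of `B₁(X)`. -/

section LinearTopology

variable {X : Type*} [TopologicalSpace X]

/-- Evaluation at a point, as a continuous linear functional on `B₁(X)`. -/
def evalCLM (x : X) : StrongDual ℝ (B1 X) :=
  (ContinuousLinearMap.proj x).comp (B1 X).subtypeL

instance : IsUniformAddGroup (B1 X) := (B1 X).toAddSubgroup.isUniformAddGroup

theorem tendsto_B1_iff {α : Type*} {l : Filter α} {u : α → B1 X} {f : B1 X} :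
    Tendsto u l (𝓝 f) ↔ ∀ x, Tendsto (fun a => (u a : X → ℝ) x) l (𝓝 ((f : X → ℝ) x)) := by
  rw [tendsto_subtype_rng, tendsto_pi_nhds]

theorem isVonNBounded_B1_iff {s : Set (B1 X)} :
    Bornology.IsVonNBounded ℝ s ↔ ∀ x, ∃ C, ∀ f ∈ s, |(f : X → ℝ) x| ≤ C := by
  constructor
  · intro hs x
    have h := (NormedSpace.isVonNBounded_iff ℝ).1 (hs.image (evalCLM x))
    obtain ⟨C, hC⟩ := isBounded_iff_forall_norm_le.1 h
    exact ⟨C, fun f hf => hC _ (mem_image_of_mem _ hf)⟩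
  · intro h
    refine Bornology.isVonNBounded_of_smul_tendsto_zero
      (ε := fun n : ℕ => 1 / ((n : ℝ) + 1)) (l := atTop)
      (Eventually.of_forall fun n => by positivity) fun u hu => ?_
    rw [tendsto_B1_iff]
    intro x
    obtain ⟨C, hC⟩ := h x
    have : Tendsto (fun n : ℕ => 1 / ((n : ℝ) + 1) * (u n : X → ℝ) x) atTop (𝓝 0) :=
      tendsto_one_div_add_atTop_nhds_zero_nat.zero_mul_isBoundedUnder_le
        (isBoundedUnder_of ⟨C, fun n => hC _ (hu n)⟩)
    simpa using this

theorem isQuasiComplete_of_isSemiMontel (h : IsSemiMontel (B1 X)) :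
    IsQuasiComplete (B1 X) := fun s hs hb => by
  have := h s hb
  rw [hs.closure_eq] at this
  exact this.isComplete

theorem isQuasiComplete_of_completeSpace [CompleteSpace (B1 X)] : IsQuasiComplete (B1 X) :=
  fun _ hs _ => hs.isComplete

/-- A Cauchy filter on a bounded set defines, by taking limits, a continuous functional on the
strong dual. Semi-reflexivity provides its limit. -/
theorem isQuasiComplete_of_isSemiReflexive (h : IsSemiReflexive (B1 X)) :
    IsQuasiComplete (B1 X) := by
  intro s hs hb l hl hls
  have := hl.1
  have hex : ∀ χ : StrongDual ℝ (B1 X), ∃ a, Tendsto χ l (𝓝 a) := fun χ =>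
    CompleteSpace.complete (hl.map χ.uniformContinuous)
  choose L hL using hex
  let Φ : StrongDual ℝ (B1 X) →ₗ[ℝ] ℝ :=
    { toFun := L
      map_add' := fun χ η => tendsto_nhds_unique (hL (χ + η)) ((hL χ).add (hL η))
      map_smul' := fun c χ => tendsto_nhds_unique (hL (c • χ)) ((hL χ).const_smul c) }
  have hΦ : Continuous Φ := by
    refine continuous_of_continuousAt_zero Φ ?_
    rw [ContinuousAt, map_zero, ContinuousLinearMap.hasBasis_nhds_zero.tendsto_iff
      Metric.nhds_basis_closedBall]
    intro ε hε
    -- If `|χ| ≤ ε` on `s`, then so is its limit along `l`, because `l` contains `s`.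
    refine ⟨(s, Metric.closedBall 0 ε), ⟨hb, Metric.closedBall_mem_nhds _ hε⟩, fun χ hχ => ?_⟩
    exact Metric.isClosed_closedBall.mem_of_tendsto (hL χ)
      (mem_of_superset (le_principal_iff.1 hls) hχ)
  obtain ⟨f, hf⟩ := h ⟨Φ, hΦ⟩
  have hlf : l ≤ 𝓝 f := by
    have : Tendsto id l (𝓝 f) := by
      rw [tendsto_B1_iff]
      intro x
      have hx : (f : X → ℝ) x = L (evalCLM x) := congr($hf (evalCLM x))
      rw [hx]
      exact hL (evalCLM x)
    exact this
  exact ⟨f, isClosed_iff_clusterPt.1 hs f (ClusterPt.mono (.of_le_nhds hlf) hls), hlf⟩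

theorem B1_eq_top_of_isQuasiComplete [T35Space X] (h : IsQuasiComplete (B1 X)) : B1 X = ⊤ := by
  rw [B1_eq_top_iff_isQfSpace]
  refine isQfSpace_of_bounded fun f hf => ?_
  set s : Set (B1 X) := {g | ∀ x, |(g : X → ℝ) x| ≤ 1} with hs
  have hclosed : IsClosed s := by
    rw [hs, ofPred_forall]
    exact isClosed_iInter fun x =>
      isClosed_le (continuous_abs.comp (evalCLM x).continuous) continuous_const
  have hcomp : IsComplete s :=
    h s hclosed (isVonNBounded_B1_iff.2 fun x => ⟨1, fun g hg => hg x⟩)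
  have himage : IsClosed (Subtype.val '' s) :=
    ((isComplete_image_iff isUniformEmbedding_subtype_val.isUniformInducing).2 hcomp).isClosed
  have hmem : f ∈ closure (Subtype.val '' s) := by
    rw [mem_closure_iff_nhds_basis' (nhds_pi (a := f) ▸ hasBasis_pi fun x => (𝓝 (f x)).basis_sets)]
    rintro ⟨I, U⟩ ⟨hI, hU⟩
    obtain ⟨g, hg1, hg⟩ := exists_continuousMap_eqOn_finset hI.toFinset f zero_le_one hf
    refine ⟨g, fun x hx => ?_, ⟨g, isBaireOne_of_continuous g⟩, hg1, rfl⟩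
    rw [hg x (hI.mem_toFinset.2 hx)]
    exact mem_of_mem_nhds (hU x hx)
  rw [himage.closure_eq] at hmem
  obtain ⟨g, -, rfl⟩ := hmem
  exact g.2

theorem isClosedEmbedding_val_of_eq_top (h : B1 X = ⊤) :
    IsClosedEmbedding (Subtype.val : B1 X → X → ℝ) :=
  ⟨IsEmbedding.subtypeVal, by
    have : range (Subtype.val : B1 X → X → ℝ) = univ := by
      rw [Subtype.range_val, h]; rfl
    rw [this]
    exact isClosed_univ⟩

theorem completeSpace_of_eq_top (h : B1 X = ⊤) : CompleteSpace (B1 X) :=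
  (completeSpace_iff_isComplete_range isUniformEmbedding_subtype_val.isUniformInducing).2
    (isClosedEmbedding_val_of_eq_top h).isClosed_range.isComplete

theorem isSemiMontel_of_eq_top (h : B1 X = ⊤) : IsSemiMontel (B1 X) := by
  intro s hs
  choose C hC using isVonNBounded_B1_iff.1 hs
  have hK : IsCompact (Subtype.val ⁻¹' (univ.pi fun x => Icc (-C x) (C x)) : Set (B1 X)) :=
    (isClosedEmbedding_val_of_eq_top h).isCompact_preimage
      (isCompact_univ_pi fun x => isCompact_Icc)
  exact hK.closure_of_subset fun f hf x _ => abs_le.1 (hC x f hf)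

/-- Every continuous functional on `B₁(X)` is a finite combination of evaluations. -/
theorem StrongDual.mem_span_range_evalCLM (χ : StrongDual ℝ (B1 X)) :
    χ ∈ Submodule.span ℝ (range (evalCLM : X → StrongDual ℝ (B1 X))) := by
  have hχ : (χ : B1 X →ₗ[ℝ] ℝ) ∈
      Submodule.span ℝ (range fun x : X => (evalCLM x : B1 X →ₗ[ℝ] ℝ)) := by
    rw [LinearMap.mem_span_iff_continuous]
    -- The topology of `B₁(X)` is the coarsest one making all evaluations continuous.
    have : (⨅ x : X, TopologicalSpace.induced (evalCLM x : B1 X →ₗ[ℝ] ℝ) inferInstance) =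
        (inferInstance : TopologicalSpace (B1 X)) := by
      change _ = TopologicalSpace.induced _ (⨅ x : X, _)
      rw [induced_iInf]
      simp only [induced_compose]
      rfl
    rw [this]
    exact χ.continuous
  have hrange : (range fun x : X => (evalCLM x : B1 X →ₗ[ℝ] ℝ)) =
      ContinuousLinearMap.coeLM ℝ '' range (evalCLM : X → StrongDual ℝ (B1 X)) := by
    rw [← range_comp]; rfl
  rw [hrange, ← Submodule.map_span] at hχ
  obtain ⟨η, hη, hηχ⟩ := hχ
  rwa [ContinuousLinearMap.coe_injective hηχ] at hη

end LinearTopology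

/-! ### Criteria for reflexivity. -/

section Bidual

variable {E : Type*} [AddCommGroup E] [Module ℝ E] [TopologicalSpace E]

/-- A linear map into a strong dual is continuous if it is small near zero, uniformly on bounded
sets. -/
theorem continuous_of_eventually_abs_apply_le [IsTopologicalAddGroup E] {F : Type*}
    [AddCommGroup F] [Module ℝ F] [TopologicalSpace F] (T : E →ₗ[ℝ] StrongDual ℝ F)
    (h : ∀ B : Set F, Bornology.IsVonNBounded ℝ B →
      ∀ ε > 0, ∀ᶠ f in 𝓝 (0 : E), ∀ χ ∈ B, |T f χ| ≤ ε) : Continuous T := by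
  refine continuous_of_continuousAt_zero T ?_
  rw [ContinuousAt, map_zero,
    (ContinuousLinearMap.hasBasis_nhds_zero_of_basis
      Metric.nhds_basis_closedBall).tendsto_right_iff]
  rintro ⟨B, ε⟩ ⟨hB, hε⟩
  filter_upwards [h B hB ε hε] with f hf χ hχ
  rw [mem_closedBall_zero_iff, Real.norm_eq_abs]
  exact hf χ hχ

/-- If strongly bounded sets of functionals are equicontinuous, then the canonical map into the
bidual is continuous. -/
theorem continuous_bidualMap [IsTopologicalAddGroup E] [ContinuousSMul ℝ E]
    (h : ∀ B : Set (StrongDual ℝ E), Bornology.IsVonNBounded ℝ B →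
      ∀ ε > 0, ∀ᶠ f in 𝓝 (0 : E), ∀ χ ∈ B, |χ f| ≤ ε) : Continuous (bidualMap E) :=
  continuous_of_eventually_abs_apply_le (bidualMap E) h

/-- A space whose elements correspond continuously to arbitrary systems of values of a spanning
family of functionals is reflexive as soon as the canonical map is continuous. -/
theorem isReflexive_of_span_eq_top [ContinuousSMul ℝ E] {ι : Type*} (δ : ι → StrongDual ℝ E)
    (hδ : ∀ χ, χ ∈ Submodule.span ℝ (range δ)) (g : (ι → ℝ) → E) (hg : Continuous g)
    (hgδ : ∀ f, g (fun i => δ i f) = f) (hδg : ∀ φ i, δ i (g φ) = φ i)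
    (hcont : Continuous (bidualMap E)) : IsReflexive E := by
  refine isHomeomorph_iff_exists_inverse.2 ⟨hcont, fun Φ => g fun i => Φ (δ i), hgδ,
    fun Φ => ?_, hg.comp (continuous_pi fun i => continuous_eval_const (δ i))⟩
  ext χ
  exact LinearMap.eqOn_span (f := (bidualMap E _ : StrongDual ℝ E →ₗ[ℝ] ℝ))
    (g := (Φ : StrongDual ℝ E →ₗ[ℝ] ℝ)) (by rintro _ ⟨i, rfl⟩; exact hδg _ i) (hδ χ)

theorem IsReflexive.isSemiReflexive [ContinuousSMul ℝ E] (h : IsReflexive E) : IsSemiReflexive E :=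
  h.bijective.surjective

end Bidual

/-! ### Reflexivity of `ℝ^X`. -/

section Reflexive

variable {X : Type*} [TopologicalSpace X]

theorem StrongDual.exists_finsupp (χ : StrongDual ℝ (B1 X)) :
    ∃ c : X →₀ ℝ, ∀ f : B1 X, χ f = c.sum fun x a => a * (f : X → ℝ) x := by
  obtain ⟨c, hc⟩ := Finsupp.mem_span_range_iff_exists_finsupp.1
    (StrongDual.mem_span_range_evalCLM χ)
  refine ⟨c, fun f => ?_⟩
  rw [← hc, Finsupp.sum, Finsupp.sum, _root_.sum_apply]
  rfl

/-- The function that is one at `x` and zero elsewhere, if all functions are Baire-one. -/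
noncomputable def pointIndicator (h : B1 X = ⊤) (x : X) : B1 X :=
  ⟨indicator {x} 1, h.ge Submodule.mem_top⟩

theorem pointIndicator_apply_self (h : B1 X = ⊤) (x : X) :
    (pointIndicator h x : X → ℝ) x = 1 := by simp [pointIndicator]

theorem pointIndicator_apply_of_ne (h : B1 X = ⊤) {x y : X} (hy : y ≠ x) :
    (pointIndicator h x : X → ℝ) y = 0 := by simp [pointIndicator, hy]

/-- The coefficients of a functional are its values on point indicators. Leaving `s` free lets one
finite set serve a whole family of functionals. -/
theorem StrongDual.apply_eq_sum (h : B1 X = ⊤) (χ : StrongDual ℝ (B1 X)) {s : Finset X}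
    (hs : ∀ x ∉ s, χ (pointIndicator h x) = 0) (f : B1 X) :
    χ f = ∑ x ∈ s, χ (pointIndicator h x) * (f : X → ℝ) x := by
  obtain ⟨c, hc⟩ := StrongDual.exists_finsupp χ
  have hcx : ∀ x, χ (pointIndicator h x) = c x := fun x => by
    rw [hc, Finsupp.sum, Finset.sum_eq_single x]
    · rw [pointIndicator_apply_self, mul_one]
    · intro y _ hy
      rw [pointIndicator_apply_of_ne h hy, mul_zero]
    · intro hx
      rw [Finsupp.notMem_support_iff.1 hx, zero_mul]
  have hsub : c.support ⊆ s := fun x hx => by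
    by_contra hxs
    exact Finsupp.mem_support_iff.1 hx ((hcx x).symm.trans (hs x hxs))
  rw [hc, Finsupp.sum_of_support_subset c hsub (fun x a => a * (f : X → ℝ) x)
    fun x _ => zero_mul _]
  exact Finset.sum_congr rfl fun x _ => by rw [hcx]

theorem exists_bound_of_isVonNBounded {B : Set (StrongDual ℝ (B1 X))}
    (hB : Bornology.IsVonNBounded ℝ B) {s : Set (B1 X)} (hs : Bornology.IsVonNBounded ℝ s) :
    ∃ C, ∀ χ ∈ B, ∀ f ∈ s, |χ f| ≤ C := by
  have h := (NormedSpace.isVonNBounded_iff ℝ).1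
    (ContinuousLinearMap.isVonNBounded_image2_apply hB hs)
  obtain ⟨C, hC⟩ := isBounded_iff_forall_norm_le.1 h
  exact ⟨C, fun χ hχ f hf => hC _ (mem_image2_of_mem hχ hf)⟩

/-- A strongly bounded set of functionals on `ℝ^X` has a common finite support. -/
theorem finite_support_of_isVonNBounded (h : B1 X = ⊤) {B : Set (StrongDual ℝ (B1 X))}
    (hB : Bornology.IsVonNBounded ℝ B) :
    {x | ∃ χ ∈ B, χ (pointIndicator h x) ≠ 0}.Finite := by
  by_contra hinf
  set ι := Set.Infinite.natEmbedding _ hinf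
  choose χ hχB hχ using fun n => (ι n).2
  -- Scaled so that `χ n (f n) = n`. At each point at most one `f n` is nonzero, so the sequence is
  -- bounded, contradicting the boundedness of `B`.
  set f : ℕ → B1 X := fun n => ((n : ℝ) / χ n (pointIndicator h (ι n))) • pointIndicator h (ι n)
    with hf
  have hb : Bornology.IsVonNBounded ℝ (range f) := by
    rw [isVonNBounded_B1_iff]
    intro x
    by_cases hx : ∃ m, (ι m : X) = x
    · obtain ⟨m, rfl⟩ := hx
      refine ⟨|(f m : X → ℝ) (ι m)|, ?_⟩
      rintro _ ⟨n, rfl⟩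
      by_cases hnm : n = m
      · rw [hnm]
      · have hne : (ι m : X) ≠ ι n := fun he => hnm (ι.injective (Subtype.ext he.symm))
        have : (f n : X → ℝ) (ι m) = 0 := by
          simp [hf, pointIndicator_apply_of_ne h hne]
        rw [this, abs_zero]
        exact abs_nonneg _
    · refine ⟨0, ?_⟩
      rintro _ ⟨n, rfl⟩
      have hne : x ≠ ι n := fun he => hx ⟨n, he.symm⟩
      simp [hf, pointIndicator_apply_of_ne h hne]
  obtain ⟨C, hC⟩ := exists_bound_of_isVonNBounded hB hb
  obtain ⟨n, hn⟩ := exists_nat_gt C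
  have hn' := hC (χ n) (hχB n) (f n) (mem_range_self n)
  rw [hf, map_smul, smul_eq_mul, div_mul_cancel₀ _ (hχ n), abs_of_nonneg n.cast_nonneg] at hn'
  exact absurd hn' hn.not_ge

/-- If `B₁(X) = ℝ^X`, strongly bounded sets of functionals are equicontinuous. -/
theorem eventually_abs_apply_le_of_eq_top (h : B1 X = ⊤) {B : Set (StrongDual ℝ (B1 X))}
    (hB : Bornology.IsVonNBounded ℝ B) {ε : ℝ} (hε : 0 < ε) :
    ∀ᶠ f in 𝓝 (0 : B1 X), ∀ χ ∈ B, |χ f| ≤ ε := by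
  -- The point indicators form a bounded set, so `C` bounds all coefficients of all functionals in
  -- `B`.
  obtain ⟨C, hC⟩ := exists_bound_of_isVonNBounded hB
    (s := range (pointIndicator h)) <| isVonNBounded_B1_iff.2 fun x => ⟨1, by
      rintro _ ⟨y, rfl⟩
      by_cases hxy : x = y
      · rw [hxy, pointIndicator_apply_self, abs_one]
      · rw [pointIndicator_apply_of_ne h hxy, abs_zero]
        exact zero_le_one⟩
  set s := (finite_support_of_isVonNBounded h hB).toFinset with hs
  have hlim : Tendsto (fun f : B1 X => ∑ x ∈ s, C * |evalCLM x f|) (𝓝 0) (𝓝 0) :=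
    Continuous.tendsto' (by fun_prop) _ _ (by simp)
  filter_upwards [hlim.eventually_le_const hε] with f hf χ hχ
  rw [StrongDual.apply_eq_sum h χ (s := s) fun x hx => by
    by_contra hne
    exact hx ((finite_support_of_isVonNBounded h hB).mem_toFinset.2 ⟨χ, hχ, hne⟩)]
  refine (Finset.abs_sum_le_sum_abs _ _).trans (le_trans (Finset.sum_le_sum fun x _ => ?_) hf)
  rw [abs_mul]
  exact mul_le_mul_of_nonneg_right (hC χ hχ _ (mem_range_self x)) (abs_nonneg _)

theorem isReflexive_of_eq_top (h : B1 X = ⊤) : IsReflexive (B1 X) :=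
  isReflexive_of_span_eq_top evalCLM StrongDual.mem_span_range_evalCLM
    (fun φ => ⟨φ, h.ge Submodule.mem_top⟩) (continuous_id.subtype_mk _) (fun _ => rfl)
    (fun _ _ => rfl)
    (continuous_bidualMap fun _ hB _ hε => eventually_abs_apply_le_of_eq_top h hB hε)

end Reflexive

end BaireOne

theorem theorem3p3 (X : Type*) [TopologicalSpace X] [T35Space X] :
    List.TFAE
      [BaireOne.IsMontel (BaireOne.B1 X),
       BaireOne.IsSemiMontel (BaireOne.B1 X),
       BaireOne.IsReflexive (BaireOne.B1 X),
       BaireOne.IsSemiReflexive (BaireOne.B1 X),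
       CompleteSpace (BaireOne.B1 X),
       BaireOne.IsQuasiComplete (BaireOne.B1 X),
       BaireOne.B1 X = ⊤,
       BaireOne.IsQfSpace X] := by
  tfae_have 1 → 2 := fun h => h.1
  tfae_have 1 → 3 := fun h => h.2
  tfae_have 3 → 4 := BaireOne.IsReflexive.isSemiReflexive
  tfae_have 2 → 6 := BaireOne.isQuasiComplete_of_isSemiMontel
  tfae_have 4 → 6 := BaireOne.isQuasiComplete_of_isSemiReflexive
  tfae_have 5 → 6 := fun _ => BaireOne.isQuasiComplete_of_completeSpace
  tfae_have 6 → 7 := BaireOne.B1_eq_top_of_isQuasiComplete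
  tfae_have 7 → 1 := fun h =>
    ⟨BaireOne.isSemiMontel_of_eq_top h, BaireOne.isReflexive_of_eq_top h⟩
  tfae_have 7 → 5 := BaireOne.completeSpace_of_eq_top
  tfae_have 7 ↔ 8 := BaireOne.B1_eq_top_iff_isQfSpace
  tfae_finish
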